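/- Let $S$ be a complete separable metric space with its Borel $\sigma$-algebra, $\pi$ a probability measure on $S$, and $Q$ a Markov transition kernel on $S$ which is reversible with respect to $\pi$; $\psi$-irreducible for some probability measure $\psi$ (for every measurable $A$ with $\psi(A)>0$ and every $x$ there is $t\ge 1$ with $Q^t(x,A)>0$); aperiodic (there are no $d\ge 2$ and disjoint measurable sets $D_0,\dots,D_{d-1}$ covering $\psi$-almost all of $S$ with $Q(x,D_{i+1 \bmod d})=1$ for all $x\in D_i$); and satisfies the geometric drift condition: there are a small set $C$ (a measurable set such that for some $t\ge 1$ and some nonzero measure $\nu$, $Q^t(x,\cdot)\ge\nu$ for all $x\in C$), constants $\beta>0$, $b<\infty$ and a measurable $V:S\to[1,\infty)$ with $QV-V\le-\beta V+b\,1_C$. Let $X_0,X_1,\dots$ be a Markov chain with transition kernel $Q$ and arbitrary initial law, and let $g\in L^2(\pi)$. Let $\gamma(k)=\mathrm{Cov}_\pi(g(X_0),g(X_{|k|}))$, $k\in\mathbb Z$, be the autocovariance sequence of the stationary chain ($X_0\sim\pi$). A representing measure of a sequence $m:\mathbb Z\to\mathbb R$ is a finite positive measure $\mu$ on $\mathbb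 R$, supported on a compact interval, such that $m(k)=\int x^{|k|}\,\mu(dx)$ for all $k\in\mathbb Z$. For $\delta>0$ and $r\in\ell_2(\mathbb Z)$ let $\Pi_\delta(r)$ be the minimizer of $\sum_{k\in\mathbb Z}(r(k)-m(k))^2$ over all $m\in\ell_2(\mathbb Z)$ that have a representing measure supported on $[-1+\delta,1-\delta]$. For each $M$ let $r_M$ be an initial autocovariance estimator, i.e. a sequence $(r_M(k))_{k\in\mathbb Z}$ computed from $X_0,\dots,X_{M-1}$, such that: (i) for each $k$, $r_M(k)\to\gamma(k)$ almost surely as $M\to\infty$; (ii) $r_M(k)=0$ for all $k\ge n(M)$, for some $n(M)<\infty$; (iii) $r_M(k)=r_M(-k)$ and $|r_M(k)|\le r_M(0)$ for all $k$. Then $\gamma$ has a unique representing measure $F$. If $\delta>0$ is such that $F$ is supported on $[-1+\delta,1-\delta]$, then almost surely the following holds: for every $M$ the moment least squares estimator $\Pi_\delta(r_M)$ exists, is unique and has a unique representing measure $\hat\mu_{\delta,M}$, and $\hat\mu_{\delta,M}\to F$ vaguely as $M\to\infty$, i.e. $\int f\,d\hat\mu_{\delta,M}\to\int f\,dF$ for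 every continuous $f:\mathbb R\to\mathbb R$ vanishing at infinity. -/

import Mathlib

open MeasureTheory ProbabilityTheory Filter Topology Set
open scoped ZeroAtInfty

noncomputable section

namespace MomentLS

section MarkovChain

variable {S Ω : Type*} [MeasurableSpace S] [MeasurableSpace Ω]

/-- `X₀, X₁, …` is a (time homogeneous) Markov chain on `(Ω, P)` with transition kernel `Q`
and arbitrary initial law: almost surely
`P(X_{t+1} ∈ A | X₀, …, X_t) = Q(X_t, A)` for every measurable `A`. -/
structure IsMarkovChain (Q : Kernel S S) (P : Measure Ω) (X : ℕ → Ω → S) : Prop where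
  measurable : ∀ t, Measurable (X t)
  markov : ∀ t, ∀ A, MeasurableSet A →
    P[(X (t + 1) ⁻¹' A).indicator (fun _ => (1 : ℝ)) |
        ⨆ j ∈ Set.Iic t, MeasurableSpace.comap (X j) inferInstance]
      =ᵐ[P] fun ω => (Q (X t ω)).real A

/-- `ψ`-irreducibility: every set of positive `ψ`-measure can be reached from every state in a
positive number of steps. -/
def IsPsiIrreducible (Q : Kernel S S) (ψ : Measure S) : Prop :=
  ∀ A, MeasurableSet A → 0 < ψ A → ∀ x, ∃ t : ℕ, 0 < t ∧ 0 < (Q ^ t) x A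

/-- `C` is a small set: some step of the chain is minorised on `C` by a nontrivial measure. -/
def IsSmallSet (Q : Kernel S S) (C : Set S) : Prop :=
  MeasurableSet C ∧ ∃ t : ℕ, 0 < t ∧ ∃ ν : Measure S, ν ≠ 0 ∧
    ∀ x ∈ C, ∀ A, MeasurableSet A → ν A ≤ (Q ^ t) x A

/-- The geometric drift condition `QV - V ≤ -βV + b 1_C` with a small set `C`, `β > 0`, `b < ∞`
and `V : S → [1, ∞)`; here `QV` is finite. -/
def HasGeometricDrift (Q : Kernel S S) : Prop :=
  ∃ (C : Set S) (β b : ℝ) (V : S → ℝ), IsSmallSet Q C ∧ 0 < β ∧ Measurable V ∧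
    (∀ x, 1 ≤ V x) ∧
    ∀ x, Integrable V (Q x) ∧
      (∫ y, V y ∂(Q x)) - V x ≤ -β * V x + b * C.indicator (fun _ => (1 : ℝ)) x

/-- Aperiodicity of a `ψ`-irreducible kernel: for no `d ≥ 2` is there a `d`-cycle, that is, a
cyclically ordered family of disjoint measurable sets `D₀, …, D_{d-1}`, covering `ψ`-almost
everything, such that the chain moves from `D_i` to `D_{i+1}` with probability one. -/
def IsAperiodic (Q : Kernel S S) (ψ : Measure S) : Prop :=
  ¬ ∃ d : ℕ, 2 ≤ d ∧ ∃ D : ZMod d → Set S,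
    (∀ i, MeasurableSet (D i)) ∧ Pairwise (fun i j => Disjoint (D i) (D j)) ∧
    (∀ i, ∀ x ∈ D i, Q x (D (i + 1)) = 1) ∧ ψ (⋃ i, D i)ᶜ = 0

/-- The autocovariance sequence `γ(k) = Cov_π (g(X₀), g(X_{|k|}))`, `k ∈ ℤ`, of the stationary
chain: if `X₀ ∼ π`, the law of `(X₀, X_{|k|})` is `π(dx) Q^{|k|}(x, dy)`. -/
def autocov (Q : Kernel S S) (π : Measure S) (g : S → ℝ) (k : ℤ) : ℝ :=
  cov[fun p : S × S => g p.1, fun p : S × S => g p.2; π ⊗ₘ (Q ^ k.natAbs)]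

/-- Admissible initial autocovariance estimates `r M ω`, `M = 0, 1, …`, of a sequence `γ`. -/
structure IsInitialEstimator (P : Measure Ω) (γ : ℤ → ℝ) (r : ℕ → Ω → ℤ → ℝ) : Prop where
  tendsto : ∀ k, ∀ᵐ ω ∂P, Tendsto (fun M => r M ω k) atTop (𝓝 (γ k))
  finite_support : ∀ M, ∀ᵐ ω ∂P, ∃ n : ℕ, ∀ k : ℤ, (n : ℤ) ≤ k → r M ω k = 0
  even : ∀ M, ∀ᵐ ω ∂P, ∀ k, r M ω k = r M ω (-k)
  peak : ∀ M, ∀ᵐ ω ∂P, ∀ k, |r M ω k| ≤ r M ω 0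

end MarkovChain

/-- `μ` is a representing measure for `m`: a finite positive measure, supported on some compact
interval, with `m(k) = ∫ x^{|k|} μ(dx)` for all `k ∈ ℤ`. -/
structure IsRepresentingMeasure (m : ℤ → ℝ) (μ : Measure ℝ) : Prop where
  finite : IsFiniteMeasure μ
  support : ∃ a b : ℝ, a ≤ b ∧ μ.support ⊆ Set.Icc a b
  moment : ∀ k : ℤ, m k = ∫ x, x ^ k.natAbs ∂μ

open Classical in
/-- The representing measure of a moment sequence (and `0` for other sequences). -/
def representingMeasure (m : ℤ → ℝ) : Measure ℝ :=
  if h : ∃ μ, IsRepresentingMeasure m μ then h.choose else 0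

/-- The sequences with a representing measure supported on `[a, b]`. -/
def momentSpace (a b : ℝ) : Set (ℤ → ℝ) :=
  {m | ∃ μ, IsRepresentingMeasure m μ ∧ μ.support ⊆ Set.Icc a b}

/-- The square summable `[-1+δ, 1-δ]`-moment sequences. -/
def momentSpaceL2 (δ : ℝ) : Set (ℤ → ℝ) :=
  {m | m ∈ momentSpace (-1 + δ) (1 - δ) ∧ Summable fun k => m k ^ 2}

/-- `m` minimises `∑ₖ (r(k) - m(k))²` over the square summable `[-1+δ, 1-δ]`-moment sequences. -/
def IsMomentLSE (δ : ℝ) (r m : ℤ → ℝ) : Prop :=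
  m ∈ momentSpaceL2 δ ∧
    ∀ m' ∈ momentSpaceL2 δ, ∑' k, (r k - m k) ^ 2 ≤ ∑' k, (r k - m' k) ^ 2

open Classical in
/-- The moment least squares estimate `Π_δ(r)` (and `0` if there is no minimiser). -/
def momentLSE (δ : ℝ) (r : ℤ → ℝ) : ℤ → ℝ :=
  if h : ∃ m, IsMomentLSE δ r m then h.choose else 0

/-- Vague convergence: `∫ f dν_n → ∫ f dν` for all continuous `f` vanishing at infinity. -/
def VaguelyTendsto (ν : ℕ → Measure ℝ) (ν' : Measure ℝ) : Prop :=
  ∀ f : C₀(ℝ, ℝ), Tendsto (fun n => ∫ x, f x ∂(ν n)) atTop (𝓝 (∫ x, f x ∂ν'))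

end MomentLS

end

/-! Moment sequences are handled by duality. An even sequence has a representing measure on `[a, b]`
exactly when its functional `X ^ n ↦ m n` is nonnegative on polynomials nonnegative there
(`mem_momentSpace_iff`, by Riesz extension and Riesz–Markov–Kakutani). Each instance of this test
involves finitely many terms, so moment sequences form a convex cone closed under pointwise limits.

The autocovariance is `⟪G, T ^ |k| G⟫` with `G` the centred `g` and `T` the transition operator on
`L²(π)`, self-adjoint by reversibility and a contraction. Nonnegativity of `p(T)` for `p ≥ 0` on
`[-1, 1]` then yields `F`.

The estimator is the Hilbert space projection of `r` onto a closed convex cone in `ℓ₂(ℤ)`. Since `r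
M` need not converge in `ℓ₂`, contractivity of the projection does not give consistency. Instead,
the variational inequality bounds `‖m - γ‖²` by `⟪r - γ, m - γ⟫`, and cone elements decay
geometrically, so only a geometrically weighted `ℓ₁` norm of `r - γ` matters. Dominated convergence,
with the peak at lag `0` as dominating constant, sends it to `0` (`tendsto_isMomentLSE`).
Convergence of moments on a compact interval gives vague convergence by Weierstrass approximation.
-/

namespace MomentLS

open scoped Polynomial ENNReal NNReal InnerProductSpace

/-! ### Moment functionals and representing measures -/

/-- The linear functional `X ^ n ↦ m n` on real polynomials. -/
noncomputable def momentFunctional (m : ℤ → ℝ) : ℝ[X] →ₗ[ℝ] ℝ :=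
  Polynomial.lsum fun n => m n • LinearMap.id

theorem momentFunctional_apply (m : ℤ → ℝ) (p : ℝ[X]) :
    momentFunctional m p = ∑ n ∈ p.support, m n * p.coeff n := by
  simp [momentFunctional, Polynomial.lsum, Polynomial.sum]

theorem momentFunctional_X_pow (m : ℤ → ℝ) (n : ℕ) :
    momentFunctional m (Polynomial.X ^ n) = m n := by
  rw [momentFunctional_apply, ← Polynomial.monomial_one_right_eq_X_pow,
    Polynomial.support_monomial _ one_ne_zero]
  simp

theorem measure_compl_Icc_eq_zero {μ : Measure ℝ} {a b : ℝ} (h : μ.support ⊆ Icc a b) :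
    μ (Icc a b)ᶜ = 0 :=
  measure_mono_null (compl_subset_compl.2 h) Measure.measure_compl_support

theorem ae_mem_Icc {μ : Measure ℝ} {a b : ℝ} (h : μ.support ⊆ Icc a b) :
    ∀ᵐ x ∂μ, x ∈ Icc a b :=
  measure_compl_Icc_eq_zero h

theorem integrable_of_continuous {μ : Measure ℝ} [IsFiniteMeasure μ] {a b : ℝ}
    (h : μ.support ⊆ Icc a b) {f : ℝ → ℝ} (hf : Continuous f) : Integrable f μ := by
  obtain ⟨C, hC⟩ := isCompact_Icc.exists_bound_of_continuousOn (hf.continuousOn (s := Icc a b))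
  exact Integrable.of_bound hf.aestronglyMeasurable C ((ae_mem_Icc h).mono hC)

theorem IsRepresentingMeasure.momentFunctional_eq {m : ℤ → ℝ} {μ : Measure ℝ}
    (h : IsRepresentingMeasure m μ) (p : ℝ[X]) :
    momentFunctional m p = ∫ x, p.eval x ∂μ := by
  have := h.finite
  obtain ⟨a, b, -, hab⟩ := h.support
  simp only [Polynomial.eval_eq_sum, Polynomial.sum]
  rw [integral_finsetSum, momentFunctional_apply]
  · refine Finset.sum_congr rfl fun n _ => ?_
    rw [integral_const_mul, h.moment n, mul_comm]
    simp
  · exact fun n _ => integrable_of_continuous hab (by fun_prop)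

theorem IsRepresentingMeasure.even {m : ℤ → ℝ} {μ : Measure ℝ}
    (h : IsRepresentingMeasure m μ) (k : ℤ) : m k = m k.natAbs := by
  rw [h.moment, h.moment, Int.natAbs_natCast]

theorem IsRepresentingMeasure.zero_eq {m : ℤ → ℝ} {μ : Measure ℝ}
    (h : IsRepresentingMeasure m μ) : m 0 = μ.real univ := by
  rw [h.moment]; simp

theorem isRepresentingMeasure_zero : IsRepresentingMeasure 0 0 where
  finite := inferInstance
  support := ⟨0, 0, le_rfl, by simp⟩
  moment := by simp

theorem momentSpace_nonneg {a b : ℝ} {m : ℤ → ℝ} (hm : m ∈ momentSpace a b) {p : ℝ[X]}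
    (hp : ∀ x ∈ Icc a b, 0 ≤ p.eval x) : 0 ≤ momentFunctional m p := by
  obtain ⟨μ, hμ, hs⟩ := hm
  rw [hμ.momentFunctional_eq]
  exact integral_nonneg_of_ae ((ae_mem_Icc hs).mono hp)

/-- The restriction of polynomials to `[a, b]`, as a linear map. -/
noncomputable def restrictPoly (a b : ℝ) : ℝ[X] →ₗ[ℝ] C(Icc a b, ℝ) :=
  (Polynomial.toContinuousMapOnAlgHom (Icc a b)).toLinearMap

theorem restrictPoly_apply (a b : ℝ) (p : ℝ[X]) (x : Icc a b) :
    restrictPoly a b p x = p.eval (x : ℝ) := rfl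

/-- On a degenerate interval, restriction of polynomials is not injective, so `L` does not visibly
descend to restrictions. The extension is therefore made on pairs `(p, f)`, with the cone `p + f ≥
0`. The pairs `(p, -p|)` and their negatives both lie in the cone, so the extension kills them and
its second component agrees with `L`. -/
theorem exists_positive_extension {a b : ℝ} {L : ℝ[X] →ₗ[ℝ] ℝ}
    (hL : ∀ p : ℝ[X], (∀ x ∈ Icc a b, 0 ≤ p.eval x) → 0 ≤ L p) :
    ∃ Λ : C(Icc a b, ℝ) →ₗ[ℝ] ℝ, (∀ f, 0 ≤ f → 0 ≤ Λ f) ∧ ∀ p, Λ (restrictPoly a b p) = L p := by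
  let s : PointedCone ℝ (ℝ[X] × C(Icc a b, ℝ)) :=
    { carrier := {z | ∀ x : Icc a b, 0 ≤ z.1.eval (x : ℝ) + z.2 x}
      add_mem' := by
        intro z w hz hw x
        have := add_nonneg (hz x) (hw x)
        simp only [Prod.fst_add, Prod.snd_add, Polynomial.eval_add, ContinuousMap.add_apply]
        linarith
      zero_mem' := by intro x; simp
      smul_mem' := by
        rintro ⟨c, hc⟩ z hz x
        have := mul_nonneg hc (hz x)
        simp only [Nonneg.mk_smul, Prod.smul_fst, Prod.smul_snd, Polynomial.eval_smul,
          ContinuousMap.smul_apply, smul_eq_mul]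
        linarith }
  let F : (ℝ[X] × C(Icc a b, ℝ)) →ₗ.[ℝ] ℝ :=
    { domain := Submodule.prod ⊤ ⊥
      toFun := L ∘ₗ LinearMap.fst ℝ _ _ ∘ₗ Submodule.subtype _ }
  obtain ⟨G, hG, hGs⟩ := riesz_extension s F
    (by
      rintro ⟨⟨p, f⟩, hpf⟩ h
      obtain rfl : f = 0 := by simpa [F] using hpf
      exact hL p fun x hx => by simpa using h ⟨x, hx⟩)
    (by
      rintro ⟨q, f⟩
      -- A large enough constant polynomial pushes any pair into the cone.
      refine ⟨⟨(Polynomial.C ‖restrictPoly a b q + f‖, 0), by simp [F]⟩, fun x => ?_⟩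
      have := (restrictPoly a b q + f).norm_coe_le_norm x
      have := (abs_le.1 this).1
      rw [ContinuousMap.add_apply, restrictPoly_apply] at this
      simp only [Prod.mk_add_mk, Polynomial.eval_add, Polynomial.eval_C, zero_add]
      linarith)
  have key : ∀ p : ℝ[X], G (p, -restrictPoly a b p) = 0 := by
    intro p
    refine le_antisymm ?_ (hGs _ fun x => ?_)
    · have := hGs (-(p, -restrictPoly a b p)) fun x => by simp [restrictPoly_apply]
      rw [map_neg] at this; linarith
    · simp [restrictPoly_apply]
  refine ⟨G ∘ₗ LinearMap.inr ℝ _ _, fun f hf => hGs _ fun x => ?_, fun p => ?_⟩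
  · simpa using hf x
  · have h1 := hG ⟨(p, 0), by simp [F]⟩
    have h2 : (p, -restrictPoly a b p) = (p, 0) - (0, restrictPoly a b p) := by simp
    have h3 := key p
    rw [h2, map_sub] at h3
    have h4 : G (p, 0) = L p := h1
    rw [← h4]; simpa using (sub_eq_zero.1 h3).symm

theorem exists_measure_of_nonneg {a b : ℝ} {L : ℝ[X] →ₗ[ℝ] ℝ}
    (hL : ∀ p : ℝ[X], (∀ x ∈ Icc a b, 0 ≤ p.eval x) → 0 ≤ L p) :
    ∃ μ : Measure ℝ, IsFiniteMeasure μ ∧ μ.support ⊆ Icc a b ∧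
      ∀ p : ℝ[X], L p = ∫ x, p.eval x ∂μ := by
  obtain ⟨Λ, hΛ, hΛL⟩ := exists_positive_extension hL
  let e : CompactlySupportedContinuousMap (Icc a b) ℝ →ₗ[ℝ] C(Icc a b, ℝ) :=
    { toFun := fun f => f.toContinuousMap
      map_add' := fun _ _ => rfl
      map_smul' := fun _ _ => rfl }
  let Λ' : CompactlySupportedContinuousMap (Icc a b) ℝ →ₚ[ℝ] ℝ :=
    PositiveLinearMap.mk₀ (Λ ∘ₗ e) fun f hf => hΛ _ fun x => hf x
  let ν := RealRMK.rieszMeasure Λ'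
  have hν : IsFiniteMeasure ν := inferInstance
  refine ⟨ν.map (↑), inferInstance, ?_, fun p => ?_⟩
  · refine Measure.support_subset_of_isClosed isClosed_Icc ?_
    rw [mem_ae_map_iff measurable_subtype_coe.aemeasurable measurableSet_Icc]
    simp
  · rw [integral_map measurable_subtype_coe.aemeasurable (by fun_prop), ← hΛL]
    exact (RealRMK.integral_rieszMeasure Λ'
      (CompactlySupportedContinuousMap.continuousMapEquiv (restrictPoly a b p))).symm

/-- A sequence has a representing measure on `[a, b]` if and only if it is even and its moment
functional is nonnegative on the polynomials that are nonnegative on `[a, b]`. -/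
theorem mem_momentSpace_iff {a b : ℝ} {m : ℤ → ℝ} :
    m ∈ momentSpace a b ↔ (∀ k : ℤ, m k = m k.natAbs) ∧
      ∀ p : ℝ[X], (∀ x ∈ Icc a b, 0 ≤ p.eval x) → 0 ≤ momentFunctional m p := by
  refine ⟨fun h => ⟨?_, fun p => momentSpace_nonneg h⟩, fun ⟨he, h⟩ => ?_⟩
  · obtain ⟨μ, hμ, -⟩ := h
    exact hμ.even
  · obtain ⟨μ, hf, hs, hμ⟩ := exists_measure_of_nonneg h
    refine ⟨μ, ⟨hf, ?_, fun k => ?_⟩, hs⟩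
    -- If `b < a` then `Icc a b` is empty; `min a b` supplies ordered endpoints in every case.
    · exact ⟨min a b, b, min_le_right _ _, hs.trans (Icc_subset_Icc_left (min_le_left _ _))⟩
    · rw [he, ← momentFunctional_X_pow m, hμ]; simp

theorem tendsto_momentFunctional {ι : Type*} {l : Filter ι} {m : ι → ℤ → ℝ} {m' : ℤ → ℝ}
    (h : ∀ k, Tendsto (fun i => m i k) l (𝓝 (m' k))) (p : ℝ[X]) :
    Tendsto (fun i => momentFunctional (m i) p) l (𝓝 (momentFunctional m' p)) := by
  simp only [momentFunctional_apply]
  exact tendsto_finsetSum _ fun n _ => (h n).mul_const _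

theorem momentSpace_of_tendsto {ι : Type*} {l : Filter ι} [l.NeBot] {m : ι → ℤ → ℝ} {m' : ℤ → ℝ}
    {a b : ℝ} (hm : ∀ i, m i ∈ momentSpace a b)
    (h : ∀ k, Tendsto (fun i => m i k) l (𝓝 (m' k))) : m' ∈ momentSpace a b := by
  refine mem_momentSpace_iff.2 ⟨fun k => ?_, fun p hp => ?_⟩
  · refine tendsto_nhds_unique (h k) ?_
    simp_rw [fun i => (mem_momentSpace_iff.1 (hm i)).1 k]
    exact h _
  · exact ge_of_tendsto' (tendsto_momentFunctional h p) fun i => momentSpace_nonneg (hm i) hp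

theorem zero_mem_momentSpace (a b : ℝ) : (0 : ℤ → ℝ) ∈ momentSpace a b :=
  ⟨0, isRepresentingMeasure_zero, by simp⟩

theorem momentSpace_add {a b : ℝ} {m m' : ℤ → ℝ} (hm : m ∈ momentSpace a b)
    (hm' : m' ∈ momentSpace a b) : m + m' ∈ momentSpace a b := by
  rw [mem_momentSpace_iff] at hm hm' ⊢
  refine ⟨fun k => ?_, fun p hp => ?_⟩
  · simp only [Pi.add_apply]; rw [hm.1, hm'.1]
  · have := add_nonneg (hm.2 p hp) (hm'.2 p hp)
    simpa [momentFunctional_apply, add_mul, Finset.sum_add_distrib] using this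

theorem momentSpace_smul {a b c : ℝ} (hc : 0 ≤ c) {m : ℤ → ℝ} (hm : m ∈ momentSpace a b) :
    c • m ∈ momentSpace a b := by
  rw [mem_momentSpace_iff] at hm ⊢
  refine ⟨fun k => ?_, fun p hp => ?_⟩
  · simp only [Pi.smul_apply]; rw [hm.1]
  · have := mul_nonneg hc (hm.2 p hp)
    simpa [momentFunctional_apply, Finset.mul_sum, mul_assoc] using this

/-- Convergence of moments on a fixed compact interval forces convergence of the integrals of
continuous functions. -/
theorem tendsto_integral_of_moments {ι : Type*} {l : Filter ι} {m : ι → ℤ → ℝ} {m' : ℤ → ℝ}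
    {μ : ι → Measure ℝ} {ν : Measure ℝ} {a b : ℝ}
    (hμ : ∀ i, IsRepresentingMeasure (m i) (μ i)) (hν : IsRepresentingMeasure m' ν)
    (hμs : ∀ i, (μ i).support ⊆ Icc a b) (hνs : ν.support ⊆ Icc a b)
    (h : ∀ k, Tendsto (fun i => m i k) l (𝓝 (m' k))) {f : ℝ → ℝ} (hf : Continuous f) :
    Tendsto (fun i => ∫ x, f x ∂(μ i)) l (𝓝 (∫ x, f x ∂ν)) := by
  have approx : ∀ (m : ℤ → ℝ) (μ : Measure ℝ), IsRepresentingMeasure m μ → μ.support ⊆ Icc a b →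
      ∀ (p : ℝ[X]) (ε : ℝ), (∀ x ∈ Icc a b, |p.eval x - f x| < ε) →
        |momentFunctional m p - ∫ x, f x ∂μ| ≤ ε * m 0 := by
    intro m μ hμ hs p ε hp
    have := hμ.finite
    rw [hμ.momentFunctional_eq, ← integral_sub (integrable_of_continuous hs (by fun_prop))
      (integrable_of_continuous hs hf), hμ.zero_eq, ← Real.norm_eq_abs]
    exact norm_integral_le_of_norm_le_const ((ae_mem_Icc hs).mono fun x hx => (hp x hx).le)
  rw [Metric.tendsto_nhds]
  intro ε hε
  have hm0 : 0 ≤ m' 0 := by rw [hν.zero_eq]; positivity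
  -- Replacing `f` by `p` costs at most `η` times the total mass on each side, in the limit `2 * η *
  -- m' 0`; the extra `2` keeps this strictly below `ε`.
  set η := ε / (2 * m' 0 + 2) with hη
  have hηpos : 0 < η := by positivity
  obtain ⟨p, hp⟩ := exists_polynomial_near_of_continuousOn a b f hf.continuousOn η hηpos
  have h1 : Tendsto (fun i => η * m i 0 + |momentFunctional (m i) p - momentFunctional m' p|
      + η * m' 0) l (𝓝 (η * m' 0 + |momentFunctional m' p - momentFunctional m' p| + η * m' 0)) :=
    (((h 0).const_mul η).add (((tendsto_momentFunctional h p).sub_const _).abs)).add_const _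
  have h2 : η * m' 0 + |momentFunctional m' p - momentFunctional m' p| + η * m' 0 < ε := by
    have : η * (2 * m' 0 + 2) = ε := by rw [hη]; field_simp
    simp only [sub_self, abs_zero]
    nlinarith
  filter_upwards [h1.eventually (gt_mem_nhds h2)] with i hi
  refine lt_of_le_of_lt ?_ hi
  rw [Real.dist_eq]
  have e1 := approx _ _ (hμ i) (hμs i) p η hp
  have e2 := approx _ _ hν hνs p η hp
  rw [abs_sub_comm] at e1
  have e3 := abs_add_three ((∫ x, f x ∂μ i) - momentFunctional (m i) p)
    (momentFunctional (m i) p - momentFunctional m' p) (momentFunctional m' p - ∫ x, f x ∂ν)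
  have e4 : (∫ x, f x ∂μ i) - momentFunctional (m i) p +
    (momentFunctional (m i) p - momentFunctional m' p) + (momentFunctional m' p - ∫ x, f x ∂ν)
      = (∫ x, f x ∂μ i) - ∫ x, f x ∂ν := by ring
  rw [e4] at e3
  linarith

/-- Convergence of integrals applied to a constant sequence, on an interval containing both
supports. -/
theorem IsRepresentingMeasure.unique {m : ℤ → ℝ} {μ ν : Measure ℝ}
    (hμ : IsRepresentingMeasure m μ) (hν : IsRepresentingMeasure m ν) : μ = ν := by
  have := hμ.finite
  have := hν.finite
  obtain ⟨a, b, -, hab⟩ := hμ.support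
  obtain ⟨a', b', -, hab'⟩ := hν.support
  refine ext_of_forall_integral_eq_of_IsFiniteMeasure fun f => ?_
  refine tendsto_nhds_unique (tendsto_const_nhds (f := (atTop : Filter ℕ)))
    (tendsto_integral_of_moments (a := min a a') (b := max b b') (fun _ => hμ) hν
      (fun _ => hab.trans ?_) (hab'.trans ?_) (fun _ => tendsto_const_nhds) f.continuous)
  · exact Icc_subset_Icc (min_le_left _ _) (le_max_left _ _)
  · exact Icc_subset_Icc (min_le_right _ _) (le_max_right _ _)

theorem representingMeasure_eq {m : ℤ → ℝ} {μ : Measure ℝ} (hμ : IsRepresentingMeasure m μ) :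
    representingMeasure m = μ := by
  have h : ∃ μ, IsRepresentingMeasure m μ := ⟨μ, hμ⟩
  rw [representingMeasure, dif_pos h]
  exact h.choose_spec.unique hμ

theorem momentSpace_bound {δ : ℝ} {m : ℤ → ℝ}
    (hm : m ∈ momentSpace (-1 + δ) (1 - δ)) (k : ℤ) :
    |m k| ≤ m 0 * max (1 - δ) 0 ^ k.natAbs := by
  obtain ⟨μ, hμ, hs⟩ := hm
  have := hμ.finite
  rw [hμ.zero_eq, hμ.moment, ← Real.norm_eq_abs, mul_comm]
  refine norm_integral_le_of_norm_le_const ((ae_mem_Icc hs).mono fun x hx => ?_)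
  rw [norm_pow, Real.norm_eq_abs]
  exact pow_le_pow_left₀ (abs_nonneg x)
    ((abs_le.2 ⟨by linarith [hx.1], hx.2⟩).trans (le_max_left _ _)) _

/-! ### Projection onto square summable moment sequences -/

theorem memℓp_two_iff {m : ℤ → ℝ} : Memℓp m 2 ↔ Summable fun k => m k ^ 2 := by
  rw [memℓp_gen_iff (by norm_num)]
  simp

theorem lp_inner_eq (x y : lp (fun _ : ℤ => ℝ) 2) : ⟪x, y⟫_ℝ = ∑' k, x k * y k := by
  rw [lp.inner_eq_tsum]
  simp [mul_comm]

theorem lp_norm_sq_eq (x : lp (fun _ : ℤ => ℝ) 2) : ‖x‖ ^ 2 = ∑' k, x k ^ 2 := by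
  rw [← real_inner_self_eq_norm_sq, lp_inner_eq]
  simp [sq]

theorem lp_summable_mul (x y : lp (fun _ : ℤ => ℝ) 2) : Summable fun k => x k * y k := by
  simpa [mul_comm] using lp.summable_inner (𝕜 := ℝ) x y

theorem lp_sq_apply_le (x : lp (fun _ : ℤ => ℝ) 2) (k : ℤ) : x k ^ 2 ≤ ‖x‖ ^ 2 := by
  rw [← sq_abs, ← Real.norm_eq_abs]
  exact pow_le_pow_left₀ (norm_nonneg _) (lp.norm_apply_le_norm two_ne_zero x k) 2

/-- The `[-1+δ, 1-δ]`-moment sequences as a subset of the Hilbert space `ℓ₂(ℤ)`. -/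
def momentCone (δ : ℝ) : Set (lp (fun _ : ℤ => ℝ) 2) :=
  {x | ⇑x ∈ momentSpace (-1 + δ) (1 - δ)}

theorem mem_momentSpaceL2_iff {δ : ℝ} {m : ℤ → ℝ} :
    m ∈ momentSpaceL2 δ ↔ ∃ x ∈ momentCone δ, ⇑x = m := by
  constructor
  · rintro ⟨h, hs⟩
    exact ⟨⟨m, memℓp_two_iff.2 hs⟩, h, rfl⟩
  · rintro ⟨x, hx, rfl⟩
    exact ⟨hx, memℓp_two_iff.1 (lp.memℓp x)⟩

theorem zero_mem_momentCone (δ : ℝ) : (0 : lp (fun _ : ℤ => ℝ) 2) ∈ momentCone δ := by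
  exact zero_mem_momentSpace _ _

theorem convex_momentCone (δ : ℝ) : Convex ℝ (momentCone δ) := by
  intro x hx y hy a b ha hb _
  exact momentSpace_add (momentSpace_smul ha hx) (momentSpace_smul hb hy)

theorem isClosed_momentCone (δ : ℝ) : IsClosed (momentCone δ) := by
  refine IsSeqClosed.isClosed fun x y hx hxy => ?_
  refine momentSpace_of_tendsto (l := atTop) hx fun k => ?_
  rw [tendsto_iff_norm_sub_tendsto_zero] at hxy ⊢
  refine squeeze_zero (fun _ => norm_nonneg _) (fun n => ?_) hxy
  simpa using lp.norm_apply_le_norm two_ne_zero (x n - y) k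

theorem isMomentLSE_iff {δ : ℝ} {r m : lp (fun _ : ℤ => ℝ) 2} :
    IsMomentLSE δ r m ↔ m ∈ momentCone δ ∧ ∀ w ∈ momentCone δ, ⟪r - m, w - m⟫_ℝ ≤ 0 := by
  have hdist : ∀ w : lp (fun _ : ℤ => ℝ) 2, ∑' k, (r k - w k) ^ 2 = ‖r - w‖ ^ 2 := by
    intro w; rw [lp_norm_sq_eq]; simp
  have hm : ⇑m ∈ momentSpaceL2 δ ↔ m ∈ momentCone δ :=
    ⟨fun h => h.1, fun h => mem_momentSpaceL2_iff.2 ⟨m, h, rfl⟩⟩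
  rw [IsMomentLSE, hm]
  refine and_congr_right fun hmK => ?_
  rw [← norm_eq_iInf_iff_real_inner_le_zero (convex_momentCone δ) hmK]
  have : Nonempty (momentCone δ) := ⟨⟨m, hmK⟩⟩
  have hbdd : BddBelow (range fun w : momentCone δ => ‖r - w‖) :=
    ⟨0, by rintro _ ⟨w, rfl⟩; exact norm_nonneg _⟩
  constructor
  · intro h
    refine le_antisymm (le_ciInf fun w => ?_) (ciInf_le hbdd ⟨m, hmK⟩)
    have := h _ (mem_momentSpaceL2_iff.2 ⟨w, w.2, rfl⟩)
    rw [hdist, hdist] at this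
    exact le_of_sq_le_sq this (norm_nonneg _)
  · intro h m' hm'
    obtain ⟨w, hw, rfl⟩ := mem_momentSpaceL2_iff.1 hm'
    rw [hdist, hdist, h]
    exact pow_le_pow_left₀ (h ▸ norm_nonneg _) (ciInf_le hbdd ⟨w, hw⟩) 2

theorem existsUnique_isMomentLSE (δ : ℝ) {r : ℤ → ℝ} (hr : Summable fun k => r k ^ 2) :
    ∃! m, IsMomentLSE δ r m := by
  obtain ⟨x, rfl⟩ : ∃ x : lp (fun _ : ℤ => ℝ) 2, ⇑x = r := ⟨⟨r, memℓp_two_iff.2 hr⟩, rfl⟩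
  obtain ⟨v, hv, hvmin⟩ := exists_norm_eq_iInf_of_complete_convex ⟨0, zero_mem_momentCone δ⟩
    (isClosed_momentCone δ).isComplete (convex_momentCone δ) x
  rw [norm_eq_iInf_iff_real_inner_le_zero (convex_momentCone δ) hv] at hvmin
  refine ⟨v, isMomentLSE_iff.2 ⟨hv, hvmin⟩, fun m hm => ?_⟩
  obtain ⟨w, hw, rfl⟩ := mem_momentSpaceL2_iff.1 hm.1
  have h1 := (isMomentLSE_iff.1 hm).2 v hv
  have h2 := hvmin w hw
  -- Sum of the two variational inequalities, each minimiser tested against the other.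
  have h3 : ⟪w - v, w - v⟫_ℝ ≤ 0 := by
    have : ⟪w - v, w - v⟫_ℝ = ⟪x - w, v - w⟫_ℝ + ⟪x - v, w - v⟫_ℝ := by
      rw [← neg_sub w v, inner_neg_right, ← sub_eq_neg_add, ← inner_sub_left]
      congr 1; abel
    linarith
  rw [real_inner_self_nonpos, sub_eq_zero] at h3
  rw [h3]

theorem momentLSE_spec {δ : ℝ} {r : ℤ → ℝ} (hr : Summable fun k => r k ^ 2) :
    IsMomentLSE δ r (momentLSE δ r) := by
  have h := (existsUnique_isMomentLSE δ hr).exists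
  rw [momentLSE, dif_pos h]
  exact h.choose_spec

/-! ### Geometric decay and consistency of the estimator -/

theorem summable_pow_natAbs {q : ℝ} (h0 : 0 ≤ q) (h1 : q < 1) :
    Summable fun k : ℤ => q ^ k.natAbs :=
  Summable.of_nat_of_neg (by simpa using summable_geometric_of_lt_one h0 h1)
    (by simpa using summable_geometric_of_lt_one h0 h1)

theorem summable_sq_of_momentSpace {δ : ℝ} (hδ : 0 < δ) {m : ℤ → ℝ}
    (hm : m ∈ momentSpace (-1 + δ) (1 - δ)) : Summable fun k => m k ^ 2 := by
  set q := max (1 - δ) 0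
  have hq0 : 0 ≤ q := le_max_right _ _
  have hq1 : q < 1 := max_lt (by linarith) one_pos
  refine Summable.of_nonneg_of_le (fun _ => sq_nonneg _) (fun k => ?_)
    ((summable_pow_natAbs hq0 hq1).mul_left (m 0 ^ 2))
  have h := momentSpace_bound hm k
  have hqk : q ^ k.natAbs ≤ 1 := pow_le_one₀ hq0 hq1.le
  have hqk0 : 0 ≤ q ^ k.natAbs := pow_nonneg hq0 _
  rw [← sq_abs]
  calc |m k| ^ 2 ≤ (m 0 * q ^ k.natAbs) ^ 2 := pow_le_pow_left₀ (abs_nonneg _) h 2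
    _ = m 0 ^ 2 * (q ^ k.natAbs * q ^ k.natAbs) := by ring
    _ ≤ m 0 ^ 2 * (q ^ k.natAbs * 1) := by gcongr
    _ = m 0 ^ 2 * q ^ k.natAbs := by ring

theorem momentSpace_zero_nonneg {a b : ℝ} {m : ℤ → ℝ} (hm : m ∈ momentSpace a b) : 0 ≤ m 0 := by
  obtain ⟨μ, hμ, -⟩ := hm
  rw [hμ.zero_eq]; positivity

/-- Testing the variational inequality at `0` gives `m 0 ^ 2 ≤ ‖m‖² ≤ ⟪r, m⟫`; the peak of `r` and
the decay of `m` bound the right side by a multiple of `r 0 * m 0`, and `m 0` cancels. -/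
theorem IsMomentLSE.zero_le {δ : ℝ} (hδ : 0 < δ) {r m : ℤ → ℝ} (hr : Summable fun k => r k ^ 2)
    (hpeak : ∀ k, |r k| ≤ r 0) (hm : IsMomentLSE δ r m) :
    m 0 ≤ (∑' k : ℤ, max (1 - δ) 0 ^ k.natAbs) * r 0 := by
  obtain ⟨x, rfl⟩ : ∃ x : lp (fun _ : ℤ => ℝ) 2, ⇑x = r := ⟨⟨r, memℓp_two_iff.2 hr⟩, rfl⟩
  obtain ⟨v, hv, rfl⟩ := mem_momentSpaceL2_iff.1 hm.1
  set q := max (1 - δ) 0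
  have hq0 : 0 ≤ q := le_max_right _ _
  have hs := summable_pow_natAbs hq0 (max_lt (by linarith) one_pos : q < 1)
  have h1 := (isMomentLSE_iff.1 hm).2 0 (zero_mem_momentCone δ)
  rw [zero_sub, inner_neg_right, inner_sub_left, real_inner_self_eq_norm_sq] at h1
  have hv0 : 0 ≤ v 0 := momentSpace_zero_nonneg hv
  have hx0 : 0 ≤ x 0 := (abs_nonneg _).trans (hpeak 0)
  have h2 : ⟪x, v⟫_ℝ ≤ ∑' k : ℤ, x 0 * v 0 * q ^ k.natAbs := by
    rw [lp_inner_eq]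
    refine (lp_summable_mul x v).tsum_le_tsum (fun k => ?_) (hs.mul_left _)
    calc x k * v k ≤ |x k| * |v k| := by rw [← abs_mul]; exact le_abs_self _
      _ ≤ x 0 * (v 0 * q ^ k.natAbs) :=
        mul_le_mul (hpeak k) (momentSpace_bound hv k) (abs_nonneg _) hx0
      _ = x 0 * v 0 * q ^ k.natAbs := by ring
  rw [tsum_mul_left] at h2
  have h3 := lp_sq_apply_le v 0
  have hC : 0 ≤ ∑' k : ℤ, q ^ k.natAbs := tsum_nonneg fun k => pow_nonneg hq0 _
  rcases hv0.eq_or_lt with h | h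
  · rw [← h]; positivity
  · refine le_of_mul_le_mul_left ?_ h
    nlinarith

/-- Testing at `γ` gives `‖m - γ‖² ≤ ⟪r - γ, m - γ⟫`, and `m - γ` decays geometrically with constant
`m 0 + γ 0`. -/
theorem IsMomentLSE.sq_sub_le {δ : ℝ} (hδ : 0 < δ) {r m γ : ℤ → ℝ}
    (hr : Summable fun k => r k ^ 2) (hm : IsMomentLSE δ r m)
    (hγ : γ ∈ momentSpace (-1 + δ) (1 - δ)) (k : ℤ)
    (hs : Summable fun j : ℤ => |r j - γ j| * max (1 - δ) 0 ^ j.natAbs) :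
    (m k - γ k) ^ 2 ≤ (m 0 + γ 0) * ∑' j : ℤ, |r j - γ j| * max (1 - δ) 0 ^ j.natAbs := by
  obtain ⟨x, rfl⟩ : ∃ x : lp (fun _ : ℤ => ℝ) 2, ⇑x = r := ⟨⟨r, memℓp_two_iff.2 hr⟩, rfl⟩
  obtain ⟨v, hv, rfl⟩ := mem_momentSpaceL2_iff.1 hm.1
  obtain ⟨c, hc, rfl⟩ := mem_momentSpaceL2_iff.1
    (⟨hγ, summable_sq_of_momentSpace hδ hγ⟩ : γ ∈ momentSpaceL2 δ)
  have h1 := (isMomentLSE_iff.1 hm).2 c hc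
  have h2 : ‖v - c‖ ^ 2 = ⟪x - c, v - c⟫_ℝ + ⟪x - v, c - v⟫_ℝ := by
    rw [← neg_sub v c, inner_neg_right, ← sub_eq_add_neg, ← inner_sub_left,
      ← real_inner_self_eq_norm_sq]
    congr 1; abel
  have h3 : ⟪x - c, v - c⟫_ℝ ≤ ∑' j : ℤ, (v 0 + c 0) * (|x j - c j| * max (1 - δ) 0 ^ j.natAbs) := by
    rw [lp_inner_eq]
    refine (lp_summable_mul _ _).tsum_le_tsum (fun j => ?_) (hs.mul_left _)
    calc (x - c) j * (v - c) j ≤ |(x - c) j * (v - c) j| := le_abs_self _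
      _ = |x j - c j| * |v j - c j| := abs_mul _ _
      _ ≤ |x j - c j| * (|v j| + |c j|) := by gcongr; exact abs_sub _ _
      _ ≤ |x j - c j| * (v 0 * max (1 - δ) 0 ^ j.natAbs + c 0 * max (1 - δ) 0 ^ j.natAbs) := by
        gcongr
        · exact momentSpace_bound hv j
        · exact momentSpace_bound hc j
      _ = _ := by ring
  rw [tsum_mul_left] at h3
  have h4 : (v k - c k) ^ 2 ≤ ‖v - c‖ ^ 2 := lp_sq_apply_le (v - c) k
  linarith

/-- Moment least squares estimates of pointwise consistent peaked inputs are consistent. -/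
theorem tendsto_isMomentLSE {δ : ℝ} (hδ : 0 < δ) {r m : ℕ → ℤ → ℝ} {γ : ℤ → ℝ}
    (hγ : γ ∈ momentSpace (-1 + δ) (1 - δ))
    (hr : ∀ k, Tendsto (fun M => r M k) atTop (𝓝 (γ k)))
    (hr2 : ∀ M, Summable fun k => r M k ^ 2) (hpeak : ∀ M k, |r M k| ≤ r M 0)
    (hm : ∀ M, IsMomentLSE δ (r M) (m M)) (k : ℤ) :
    Tendsto (fun M => m M k) atTop (𝓝 (γ k)) := by
  set q := max (1 - δ) 0 with hq
  have hq0 : 0 ≤ q := le_max_right _ _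
  have hq1 : q < 1 := max_lt (by linarith) one_pos
  have hs := summable_pow_natAbs hq0 hq1
  have hγk : ∀ j, |γ j| ≤ γ 0 := fun j => (momentSpace_bound hγ j).trans
    (mul_le_of_le_one_right (momentSpace_zero_nonneg hγ) (pow_le_one₀ hq0 hq1.le))
  have hbound : ∀ M j, |r M j - γ j| ≤ r M 0 + γ 0 := fun M j =>
    (abs_sub _ _).trans (add_le_add (hpeak M j) (hγk j))
  have hsum : ∀ M, Summable fun j : ℤ => |r M j - γ j| * q ^ j.natAbs := fun M =>
    Summable.of_nonneg_of_le (fun j => by positivity)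
      (fun j => mul_le_mul_of_nonneg_right (hbound M j) (pow_nonneg hq0 _))
      (hs.mul_left (r M 0 + γ 0))
  have hD : Tendsto (fun M => ∑' j : ℤ, |r M j - γ j| * q ^ j.natAbs) atTop (𝓝 0) := by
    rw [← tsum_zero (α := ℝ) (β := ℤ)]
    -- Once `r M 0 < γ 0 + 1`, the peak property dominates all lags at once.
    refine tendsto_tsum_of_dominated_convergence (hs.mul_left (γ 0 + 1 + γ 0)) (fun j => ?_) ?_
    · have := ((hr j).sub_const (γ j)).abs.mul_const (q ^ j.natAbs)
      simpa using this
    · filter_upwards [(hr 0).eventually (gt_mem_nhds (lt_add_one (γ 0)))] with M hM j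
      rw [Real.norm_eq_abs, abs_of_nonneg (by positivity)]
      exact mul_le_mul_of_nonneg_right ((hbound M j).trans (by linarith)) (pow_nonneg hq0 _)
  set C := ∑' j : ℤ, q ^ j.natAbs with hC
  have hup : Tendsto (fun M => (C * r M 0 + γ 0) * ∑' j : ℤ, |r M j - γ j| * q ^ j.natAbs)
      atTop (𝓝 0) := by
    simpa using (((hr 0).const_mul C).add_const (γ 0)).mul hD
  have hsq : Tendsto (fun M => (m M k - γ k) ^ 2) atTop (𝓝 0) := by
    refine squeeze_zero (fun _ => sq_nonneg _) (fun M => ?_) hup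
    refine ((hm M).sq_sub_le hδ (hr2 M) hγ k (hsum M)).trans ?_
    refine mul_le_mul_of_nonneg_right ?_ (tsum_nonneg fun j => by positivity)
    have := (hm M).zero_le hδ (hr2 M) (hpeak M)
    linarith
  have habs : Tendsto (fun M => |m M k - γ k|) atTop (𝓝 0) := by
    have := hsq.sqrt
    simpa [Real.sqrt_sq_eq_abs] using this
  rw [tendsto_iff_norm_sub_tendsto_zero]
  exact habs

theorem summable_sq_of_even_of_eventually_zero {r : ℤ → ℝ} (he : ∀ k, r k = r (-k))
    {n : ℕ} (hn : ∀ k : ℤ, (n : ℤ) ≤ k → r k = 0) : Summable fun k => r k ^ 2 := by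
  refine summable_of_ne_finset_zero (s := Finset.Ioo (-n : ℤ) n) fun k hk => ?_
  rw [Finset.mem_Ioo, not_and_or, not_lt, not_lt] at hk
  rcases hk with hk | hk
  · rw [he, hn _ (by omega)]; simp
  · rw [hn _ hk]; simp

/-! ### Moments of self-adjoint contractions -/

/-- The moment functional is `p ↦ ⟪v, p(T) v⟫`, and `p(T) ≥ 0` when `p ≥ 0` on `[-1, 1]`, which
contains the spectrum. -/
theorem mem_momentSpace_of_isSelfAdjoint {E : Type*} [NormedAddCommGroup E]
    [InnerProductSpace ℂ E] [CompleteSpace E] {T : E →L[ℂ] E} (hT : IsSelfAdjoint T)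
    (hnorm : ‖T‖ ≤ 1) (v : E) {m : ℤ → ℝ}
    (hm : ∀ k : ℤ, m k = (⟪v, (T ^ k.natAbs) v⟫_ℂ).re) : m ∈ momentSpace (-1) 1 := by
  refine mem_momentSpace_iff.2 ⟨fun k => by rw [hm, hm, Int.natAbs_natCast], fun p hp => ?_⟩
  have hspec : ∀ x ∈ spectrum ℝ T, x ∈ Icc (-1 : ℝ) 1 := by
    intro x hx
    have h1 := spectrum.norm_le_norm_mul_of_mem hx
    -- Only an inequality, since `E` may be trivial.
    have h2 : ‖(1 : E →L[ℂ] E)‖ ≤ 1 := ContinuousLinearMap.norm_id_le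
    exact abs_le.1 (h1.trans (mul_le_one₀ hnorm (norm_nonneg _) h2))
  have hpos : 0 ≤ Polynomial.aeval T p := by
    rw [← cfc_polynomial p T]
    exact cfc_nonneg fun x hx => hp x (hspec x hx)
  have hsum : momentFunctional m p = (⟪v, Polynomial.aeval T p v⟫_ℂ).re := by
    rw [momentFunctional_apply, Polynomial.aeval_def, Polynomial.eval₂_eq_sum, Polynomial.sum,
      sum_apply, inner_sum, Complex.re_sum]
    refine Finset.sum_congr rfl fun n _ => ?_
    rw [hm, Int.natAbs_natCast, ← Algebra.smul_def, smul_apply,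
      inner_smul_right_eq_smul, Complex.smul_re, smul_eq_mul, mul_comm]
  rw [hsum]
  have h := ((ContinuousLinearMap.nonneg_iff_isPositive _).1 hpos).re_inner_nonneg_right v
  simpa using h

/-! ### The transition operator of a reversible kernel -/

section Operator

variable {S : Type*} [MeasurableSpace S] {Q : Kernel S S} {π : Measure S}

theorem isMarkovKernel_pow [IsMarkovKernel Q] (n : ℕ) : IsMarkovKernel (Q ^ n) := by
  induction n with
  | zero => rw [pow_zero]; exact inferInstanceAs (IsMarkovKernel Kernel.id)
  | succ n ih => rw [pow_succ]; exact inferInstanceAs (IsMarkovKernel ((Q ^ n) ∘ₖ Q))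

theorem invariant_pow (h : Q.Invariant π) (n : ℕ) : (Q ^ n).Invariant π := by
  induction n with
  | zero => rw [pow_zero]; exact Measure.id_comp
  | succ n ih => rw [pow_succ]; exact ih.comp h

variable [IsProbabilityMeasure π]

theorem measurePreserving_fst_compProd (κ : Kernel S S) [IsMarkovKernel κ] :
    MeasurePreserving Prod.fst (π ⊗ₘ κ) π :=
  ⟨measurable_fst, Measure.fst_compProd π κ⟩

theorem measurePreserving_snd_compProd {κ : Kernel S S} [IsMarkovKernel κ]
    (h : κ.Invariant π) : MeasurePreserving Prod.snd (π ⊗ₘ κ) π :=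
  ⟨measurable_snd, (Measure.snd_compProd π κ).trans h⟩

theorem measurePreserving_swap_compProd [IsMarkovKernel Q] (h : Q.IsReversible π) :
    MeasurePreserving Prod.swap (π ⊗ₘ Q) (π ⊗ₘ Q) := by
  refine ⟨measurable_swap, ?_⟩
  refine Measure.ext_prod fun {s t} hs ht => ?_
  rw [Measure.map_apply measurable_swap (hs.prod ht), preimage_swap_prod,
    Measure.compProd_apply_prod ht hs, Measure.compProd_apply_prod hs ht]
  exact h ht hs

/-- The transition operator of a kernel with invariant measure `π` on `L²(π)`. -/
noncomputable def transitionOp [IsMarkovKernel Q] (h : Q.Invariant π) :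
    Lp ℂ 2 π →L[ℂ] Lp ℂ 2 π :=
  (Lp.compMeasurePreservingₗᵢ ℂ Prod.fst
    (measurePreserving_fst_compProd Q)).toContinuousLinearMap.adjoint ∘L
  (Lp.compMeasurePreservingₗᵢ ℂ Prod.snd
    (measurePreserving_snd_compProd h)).toContinuousLinearMap

variable [IsMarkovKernel Q]

theorem inner_transitionOp (h : Q.Invariant π) (u f : Lp ℂ 2 π) :
    ⟪u, transitionOp h f⟫_ℂ =
      ⟪Lp.compMeasurePreserving Prod.fst (measurePreserving_fst_compProd Q) u,
        Lp.compMeasurePreserving Prod.snd (measurePreserving_snd_compProd h) f⟫_ℂ := by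
  rw [transitionOp, ContinuousLinearMap.comp_apply, ContinuousLinearMap.adjoint_inner_right]
  rfl

theorem inner_transitionOp_eq_integral (h : Q.Invariant π) (u f : Lp ℂ 2 π) :
    ⟪u, transitionOp h f⟫_ℂ = ∫ p, ⟪u p.1, f p.2⟫_ℂ ∂(π ⊗ₘ Q) := by
  rw [inner_transitionOp, L2.inner_def]
  refine integral_congr_ae ?_
  filter_upwards [Lp.coeFn_compMeasurePreserving u (measurePreserving_fst_compProd Q),
    Lp.coeFn_compMeasurePreserving f (measurePreserving_snd_compProd h)] with p h1 h2
  rw [h1, h2]; rfl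

theorem norm_transitionOp_le (h : Q.Invariant π) : ‖transitionOp h‖ ≤ 1 := by
  refine (ContinuousLinearMap.opNorm_comp_le _ _).trans ?_
  rw [LinearIsometryEquiv.norm_map]
  exact mul_le_one₀ (LinearIsometry.norm_toContinuousLinearMap_le _) (norm_nonneg _)
    (LinearIsometry.norm_toContinuousLinearMap_le _)

/-- `⟪u, T f⟫` integrates `conj u(x) * f(y)` against the law of two consecutive stationary states,
which reversibility makes invariant under swapping. -/
theorem isSelfAdjoint_transitionOp (hrev : Q.IsReversible π) :
    IsSelfAdjoint (transitionOp hrev.invariant) := by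
  rw [ContinuousLinearMap.isSelfAdjoint_iff_isSymmetric]
  intro f u
  change ⟪transitionOp hrev.invariant f, u⟫_ℂ = ⟪f, transitionOp hrev.invariant u⟫_ℂ
  rw [← inner_conj_symm, inner_transitionOp_eq_integral, inner_transitionOp_eq_integral,
    ← integral_conj]
  simp_rw [inner_conj_symm]
  exact (measurePreserving_swap_compProd hrev).integral_comp'
    (f := MeasurableEquiv.prodComm) (fun p => ⟪f p.1, u p.2⟫_ℂ)

theorem integrable_snd_compProd {κ : Kernel S S} [IsMarkovKernel κ] (h : κ.Invariant π)
    {f : S → ℂ} (hf : MemLp f 2 π) : Integrable (fun p : S × S => f p.2) (π ⊗ₘ κ) :=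
  (measurePreserving_snd_compProd h).integrable_comp_of_integrable (hf.integrable one_le_two)

/-- Both sides have the same integral over every measurable set, as seen by pairing with indicators.
-/
theorem transitionOp_ae_eq (h : Q.Invariant π) (f : Lp ℂ 2 π) :
    transitionOp h f =ᵐ[π] fun x => ∫ y, f y ∂(Q x) := by
  have hint := integrable_snd_compProd h (Lp.memLp f)
  refine Integrable.ae_eq_of_forall_setIntegral_eq _ _
    ((Lp.memLp _).integrable one_le_two) hint.integral_compProd fun s hs _ => ?_
  have h1 := L2.inner_indicatorConstLp_one (𝕜 := ℂ) hs (measure_ne_top π s) (transitionOp h f)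
  rw [← h1, inner_transitionOp, Lp.indicatorConstLp_compMeasurePreserving,
    L2.inner_indicatorConstLp_one]
  have h2 := Measure.setIntegral_compProd hs MeasurableSet.univ (hint.integrableOn (s := s ×ˢ univ))
  simp only [Measure.restrict_univ] at h2
  rw [← h2, ← prod_univ]
  exact setIntegral_congr_ae (hs.prod MeasurableSet.univ)
    ((Lp.coeFn_compMeasurePreserving f (measurePreserving_snd_compProd h)).mono fun p hp _ => hp)

theorem transitionOp_pow_ae_eq (h : Q.Invariant π) (n : ℕ) (f : Lp ℂ 2 π) :
    (transitionOp h ^ n) f =ᵐ[π] fun x => ∫ y, f y ∂((Q ^ n) x) := by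
  induction n generalizing f with
  | zero =>
    have hf := (Lp.stronglyMeasurable f)
    refine Eventually.of_forall fun x => ?_
    simp only [pow_zero, one_apply_eq_self]
    change _ = ∫ y, f y ∂(Kernel.id x)
    rw [Kernel.id_apply, integral_dirac' _ _ hf]
  | succ n ih =>
    have := isMarkovKernel_pow (Q := Q) n
    have := isMarkovKernel_pow (Q := Q) (n + 1)
    rw [pow_succ, mul_apply_eq_comp]
    -- The one-step formula holds only `π`-a.e.; invariance of `π` under `Q ^ n` makes it hold `(Q ^
    -- n) x`-a.e. for `π`-almost every `x`.
    have h1 : ∀ᵐ p ∂(π ⊗ₘ (Q ^ n)), transitionOp h f p.2 = ∫ z, f z ∂(Q p.2) :=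
      (measurePreserving_snd_compProd (invariant_pow h n)).quasiMeasurePreserving.ae
        (transitionOp_ae_eq h f)
    have h2 := (integrable_snd_compProd (invariant_pow h (n + 1)) (Lp.memLp f)).ae_of_compProd
    filter_upwards [ih (transitionOp h f), Measure.ae_ae_of_ae_compProd h1, h2] with x hx hx1 hx2
    rw [hx, integral_congr_ae hx1]
    have hpow : Q ^ (n + 1) = Q ∘ₖ (Q ^ n) := pow_succ' Q n
    have hx2' : Integrable (fun y => f y) ((Q ^ (n + 1)) x) := hx2
    rw [hpow] at hx2' ⊢
    rw [Kernel.integral_comp hx2']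

theorem autocov_eq_inner (hinv : Q.Invariant π) {g : S → ℝ} (hg : MemLp g 2 π) :
    ∃ G : Lp ℂ 2 π, ∀ k : ℤ,
      autocov Q π g k = (⟪G, (transitionOp hinv ^ k.natAbs) G⟫_ℂ).re := by
  set c := ∫ x, g x ∂π with hc
  have hg0 : MemLp (fun x => g x - c) 2 π := hg.sub (memLp_const c)
  have hG : MemLp (fun x => ((g x - c : ℝ) : ℂ)) 2 π := hg0.ofReal
  refine ⟨hG.toLp _, fun k => ?_⟩
  set n := k.natAbs
  have := isMarkovKernel_pow (Q := Q) n
  have hfst : MeasurePreserving Prod.fst (π ⊗ₘ (Q ^ n)) π := measurePreserving_fst_compProd _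
  have hsnd := measurePreserving_snd_compProd (invariant_pow hinv n)
  have hi1 : ∫ p, g p.1 ∂(π ⊗ₘ (Q ^ n)) = c := by
    rw [hc, ← hfst.map_eq, integral_map measurable_fst.aemeasurable]
    · rw [hfst.map_eq]
    · rw [hfst.map_eq]; exact hg.1
  have hi2 : ∫ p, g p.2 ∂(π ⊗ₘ (Q ^ n)) = c := by
    rw [hc, ← hsnd.map_eq, integral_map measurable_snd.aemeasurable]
    · rw [hsnd.map_eq]
    · rw [hsnd.map_eq]; exact hg.1
  have hint : Integrable (fun p : S × S => (g p.1 - c) * (g p.2 - c)) (π ⊗ₘ (Q ^ n)) :=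
    (hg0.comp_measurePreserving hfst).integrable_mul (hg0.comp_measurePreserving hsnd)
  have hcov : autocov Q π g k = ∫ x, (g x - c) * ∫ y, (g y - c) ∂((Q ^ n) x) ∂π := by
    rw [autocov, covariance, hi1, hi2, Measure.integral_compProd hint]
    simp_rw [integral_const_mul]
  have hae : ∀ᵐ p ∂(π ⊗ₘ (Q ^ n)), hG.toLp _ p.2 = ((g p.2 - c : ℝ) : ℂ) :=
    hsnd.quasiMeasurePreserving.ae hG.coeFn_toLp
  have hinner : ⟪hG.toLp _, (transitionOp hinv ^ n) (hG.toLp _)⟫_ℂ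
      = ((∫ x, (g x - c) * ∫ y, (g y - c) ∂((Q ^ n) x) ∂π : ℝ) : ℂ) := by
    rw [L2.inner_def, ← integral_complex_ofReal]
    refine integral_congr_ae ?_
    filter_upwards [hG.coeFn_toLp, transitionOp_pow_ae_eq hinv n (hG.toLp _),
      Measure.ae_ae_of_ae_compProd hae] with x h1 h2 h3
    rw [h1, h2, integral_congr_ae h3, integral_complex_ofReal, RCLike.inner_apply,
      Complex.conj_ofReal, Complex.ofReal_mul, mul_comm]
  rw [hinner, Complex.ofReal_re, hcov]

/-- The autocovariance sequence of a reversible chain is a `[-1, 1]`-moment sequence. -/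
theorem autocov_mem_momentSpace (hrev : Q.IsReversible π) {g : S → ℝ} (hg : MemLp g 2 π) :
    autocov Q π g ∈ momentSpace (-1) 1 := by
  obtain ⟨G, hG⟩ := autocov_eq_inner hrev.invariant hg
  exact mem_momentSpace_of_isSelfAdjoint (isSelfAdjoint_transitionOp hrev)
    (norm_transitionOp_le _) G hG

end Operator

end MomentLS

/-! ### The consistency theorem -/

theorem mainTheorem3 {S Ω : Type*}
    [MetricSpace S] [CompleteSpace S] [TopologicalSpace.SeparableSpace S]
    [MeasurableSpace S] [BorelSpace S]
    [MeasurableSpace Ω] (P : Measure Ω) [IsProbabilityMeasure P]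
    (Q : Kernel S S) [IsMarkovKernel Q]
    (π : Measure S) [IsProbabilityMeasure π] (hrev : Q.IsReversible π)
    (ψ : Measure S) [IsProbabilityMeasure ψ] (hirr : MomentLS.IsPsiIrreducible Q ψ)
    (hdrift : MomentLS.HasGeometricDrift Q)
    (haper : MomentLS.IsAperiodic Q ψ)
    (X : ℕ → Ω → S) (hX : MomentLS.IsMarkovChain Q P X)
    (g : S → ℝ) (hg : MemLp g 2 π)
    (r : (M : ℕ) → (Fin M → S) → ℤ → ℝ)
    (hr : MomentLS.IsInitialEstimator P (MomentLS.autocov Q π g)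
      (fun M ω => r M (fun i => X i ω))) :
    (∃! F, MomentLS.IsRepresentingMeasure (MomentLS.autocov Q π g) F) ∧
    ∀ δ : ℝ, 0 < δ →
      (MomentLS.representingMeasure (MomentLS.autocov Q π g)).support
        ⊆ Set.Icc (-1 + δ) (1 - δ) →
      ∀ᵐ ω ∂P,
        (∀ M : ℕ, (∃! m, MomentLS.IsMomentLSE δ (r M (fun i => X i ω)) m) ∧
          ∃! μ, MomentLS.IsRepresentingMeasure
            (MomentLS.momentLSE δ (r M (fun i => X i ω))) μ) ∧
        MomentLS.VaguelyTendsto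
          (fun M => MomentLS.representingMeasure
            (MomentLS.momentLSE δ (r M (fun i => X i ω))))
          (MomentLS.representingMeasure (MomentLS.autocov Q π g)) := by
  obtain ⟨F, hF, -⟩ := MomentLS.autocov_mem_momentSpace hrev hg
  refine ⟨⟨F, hF, fun F' hF' => hF'.unique hF⟩, fun δ hδ hsupp => ?_⟩
  rw [MomentLS.representingMeasure_eq hF] at hsupp ⊢
  -- Lags and sample sizes are countable, so one null set serves for all of them.
  filter_upwards [ae_all_iff.2 hr.tendsto, ae_all_iff.2 hr.finite_support,
    ae_all_iff.2 hr.even, ae_all_iff.2 hr.peak] with ω htend hfin heven hpeak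
  have hsum : ∀ M, Summable fun k => r M (fun i => X i ω) k ^ 2 := fun M =>
    (hfin M).elim fun _ hn => MomentLS.summable_sq_of_even_of_eventually_zero (heven M) hn
  have hlse := fun M => MomentLS.momentLSE_spec (δ := δ) (hsum M)
  have hrep : ∀ M, ∃ μ, MomentLS.IsRepresentingMeasure
      (MomentLS.momentLSE δ (r M (fun i => X i ω))) μ ∧ μ.support ⊆ Set.Icc (-1 + δ) (1 - δ) :=
    fun M => (hlse M).1.1
  choose μ hμ hμs using hrep
  refine ⟨fun M => ⟨MomentLS.existsUnique_isMomentLSE δ (hsum M),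
    μ M, hμ M, fun ν hν => hν.unique (hμ M)⟩, fun f => ?_⟩
  simp_rw [fun M => MomentLS.representingMeasure_eq (hμ M)]
  exact MomentLS.tendsto_integral_of_moments hμ hF hμs hsupp
    (MomentLS.tendsto_isMomentLSE hδ ⟨F, hF, hsupp⟩ htend hsum hpeak hlse) f.continuous
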